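/- Let $\mathfrak U$ be a Grothendieck universe that contains an infinite set, let $G$ be a group in $\mathfrak U$ and let $M$ be an abelian $G$-module in $\mathfrak U$, written additively. **Cohomology.** Let $C^n(G,M)=\mathrm{Map}(G^{n},M)$ be the inhomogeneous cochain complex, with cocycles $Z^n$, coboundaries $B^n$ and $H^n(G,M)=Z^n/B^n$. A cochain is componentwise pointed if it vanishes whenever one of its arguments is $1$. Let $Z^n_{\mathrm{cpt}}$ and $B^n_{\mathrm{cpt}}$ be the groups of componentwise pointed cocycles and coboundaries, and let $H^n_{\mathrm{cpt}}(G,M)=Z^n_{\mathrm{cpt}}/B^n_{\mathrm{cpt}}$. **Extensions.** A crossed module consists of a group $E_0$, a group $E_1$ on which $E_0$ acts by automorphisms and a homomorphism $\mu\colon E_1\to E_0$ with $\mu({}^{e}x)=e\,\mu(x)\,e^{-1}$ and ${}^{\mu(y)}x=yxy^{-1}$. A crossed module extension $E$ of $G$ with $M$ is a crossed module together with an exact sequence of groups $M\xrightarrow{\iota}E_1\xrightarrow{\mu}E_0\xrightarrow{\pi}G$ with $\iota$ injective, $\pi$ surjective and ${}^{e}\iota(m)=\iota(\pi(e)m)$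 for $e\in E_0$, $m\in M$. An extension equivalence is a morphism of crossed modules that is compatible with the maps $\iota$ and $\pi$. Let $\mathrm{Ext}^2(G,M)$ be the set of crossed module extensions in $\mathfrak U$ modulo the equivalence relation generated by the existence of an extension equivalence. The trivial extension is $M\xrightarrow{\mathrm{id}}M\xrightarrow{1}G\xrightarrow{\mathrm{id}}G$, with the given action of $G$ on $M$. **Associated class.** For an extension $E$ choose a pointed section $Z^1\colon G\to E_0$ of $\pi$ and a map $Z^2\colon G\times G\to E_1$ with $\mu(Z^2(h,g))=Z^1(h)Z^1(g)Z^1(hg)^{-1}$ and $Z^2(1,g)=Z^2(g,1)=1$. Then $$c^3(k,h,g)=\iota^{-1}\Bigl(Z^2(k,h)\,Z^2(kh,g)\,Z^2(k,hg)^{-1}\,\bigl({}^{Z^1(k)}Z^2(h,g)\bigr)^{-1}\Bigr)$$ is a componentwise pointed $3$-cocycle. Its class $\mathrm{cl}(E)\in H^3_{\mathrm{cpt}}(G,M)$ depends only on the class of $E$ in $\mathrm{Ext}^2(G,M)$. **Standard extension.** For $z\in Z^3_{\mathrm{cpt}}(G,M)$ let $F$ be a free group on the pointed set $(G,1)$ with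 basis $s\colon G\to F$, let $\pi\colon F\to G$ be the homomorphism with $\pi(s(g))=g$, and put $c(h,g)=s(h)s(g)s(hg)^{-1}\in\ker\pi$. The standard extension $\mathrm{E}(z)$ is $M\to M\times\ker\pi\to F\xrightarrow{\pi}G$, with the canonical inclusion $M\to M\times\ker\pi$ and the projection $M\times\ker\pi\to\ker\pi\subseteq F$, where the action of $F$ on $M\times\ker\pi$ is determined by $${}^{s(k)}(m,1)=(km,1),\qquad {}^{s(k)}(0,c(h,g))=\bigl(-z(k,h,g),\;c(k,h)\,c(kh,g)\,c(k,hg)^{-1}\bigr).$$ The class of $\mathrm{E}(z)$ in $\mathrm{Ext}^2(G,M)$ depends only on the class of $z$ in $H^3_{\mathrm{cpt}}(G,M)$. **Theorem.** The maps $$\mathrm{Ext}^2(G,M)\to H^3_{\mathrm{cpt}}(G,M),\ [E]\mapsto\mathrm{cl}(E),\qquad\text{and}\qquad H^3_{\mathrm{cpt}}(G,M)\to\mathrm{Ext}^2(G,M),\ z+B^3_{\mathrm{cpt}}(G,M)\mapsto[\mathrm{E}(z)],$$ are mutually inverse bijections, under which the class of the trivial extension corresponds to $0$. In particular, $\mathrm{Ext}^2(G,M)$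 is in bijection with $H^3(G,M)$: the composite of the first map with the canonical map $H^3_{\mathrm{cpt}}(G,M)\to H^3(G,M)$, $z+B^3_{\mathrm{cpt}}(G,M)\mapsto z+B^3(G,M)$, is bijective. -/

import Mathlib

universe u

noncomputable section

namespace CrossedExt

open CategoryTheory

/-! ## Group cohomology and componentwise pointed cochains -/

section Cohomology

variable (G M : Type u) [Group G] [AddCommGroup M] [DistribMulAction G M]

instance smulCommClassULiftInt : SMulCommClass G (ULift.{u} ℤ) M :=
  ⟨fun g n m => smul_comm g n.down m⟩

/-- The abelian `G`-module `M` as a representation. Mathlib wants the coefficient ring to live in the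
universe of `G`, so `ℤ` is lifted there; a module over `ULift ℤ` is an abelian group. -/
abbrev coeffRep : Rep.{u} (ULift.{u} ℤ) G :=
  Rep.ofDistribMulAction (ULift.{u} ℤ) G M

/-- The differential `Cⁿ(G, M) → Cⁿ⁺¹(G, M)` of the complex of inhomogeneous cochains,
`Cⁿ(G, M) = Map(Gⁿ, M)`; see `differential_apply` for the formula. -/
def differential (n : ℕ) : ((Fin n → G) → M) →+ ((Fin (n + 1) → G) → M) :=
  (inhomogeneousCochains.d (coeffRep G M) n).hom.toAddMonoidHom

variable {G M} in
theorem differential_apply (n : ℕ) (c : (Fin n → G) → M) (x : Fin (n + 1) → G) :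
    differential G M n c x = x 0 • c (fun i => x i.succ) +
      ∑ j : Fin (n + 1), (-1 : ℤ) ^ ((j : ℕ) + 1) • c (Fin.contractNth j (· * ·) x) := by
  have h : ∀ k : ℕ, ((-1 : ULift.{u} ℤ) ^ k).down = (-1 : ℤ) ^ k := by
    intro k
    induction k with
    | zero => rfl
    | succ k ih => rw [pow_succ, pow_succ, ← ih]; rfl
  change x 0 • c (fun i => x i.succ) + ∑ j : Fin (n + 1),
    ((-1 : ULift.{u} ℤ) ^ ((j : ℕ) + 1)).down • c (Fin.contractNth j (· * ·) x) = _
  simp only [h]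

/-- The group `Zⁿ(G, M)` of `n`-cocycles. -/
def cocycles (n : ℕ) : AddSubgroup ((Fin n → G) → M) :=
  (differential G M n).ker

/-- The group `Bⁿ(G, M)` of `n`-coboundaries. -/
def coboundaries : (n : ℕ) → AddSubgroup ((Fin n → G) → M)
  | 0 => ⊥
  | n + 1 => (differential G M n).range

/-- The group of componentwise pointed `n`-cochains: those that vanish as soon as one of the
arguments is `1`. -/
def cptCochains (n : ℕ) : AddSubgroup ((Fin n → G) → M) where
  carrier := {c | ∀ x : Fin n → G, (∃ i, x i = 1) → c x = 0}
  zero_mem' := fun _ _ => rfl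
  add_mem' := fun {a b} ha hb x hx => by
    rw [Pi.add_apply, ha x hx, hb x hx, add_zero]
  neg_mem' := fun {a} ha x hx => by
    rw [Pi.neg_apply, ha x hx, neg_zero]

/-- The group `Zⁿ_cpt(G, M)` of componentwise pointed `n`-cocycles. -/
def cptCocycles (n : ℕ) : AddSubgroup ((Fin n → G) → M) :=
  cptCochains G M n ⊓ cocycles G M n

/-- The group `Bⁿ_cpt(G, M)` of componentwise pointed `n`-coboundaries. -/
def cptCoboundaries (n : ℕ) : AddSubgroup ((Fin n → G) → M) :=
  cptCochains G M n ⊓ coboundaries G M n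

/-- The group `Hⁿ_cpt(G, M) = Zⁿ_cpt(G, M) / Bⁿ_cpt(G, M)`. -/
abbrev CptCohomology (n : ℕ) : Type u :=
  ↥(cptCocycles G M n) ⧸ (cptCoboundaries G M n).addSubgroupOf (cptCocycles G M n)

/-- The cohomology class in `Hⁿ_cpt(G, M)` of a componentwise pointed `n`-cocycle. -/
abbrev cptClass {n : ℕ} (z : cptCocycles G M n) : CptCohomology G M n :=
  QuotientAddGroup.mk z

/-- The group `Hⁿ(G, M)`. -/
abbrev Cohomology (n : ℕ) : Type u :=
  groupCohomology (coeffRep G M) n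

/-- The class in `Hⁿ(G, M)` of an `n`-cocycle. -/
def cocyclesToCohomology (n : ℕ) : cocycles G M n →+ Cohomology G M n :=
  AddMonoidHom.mk'
    (fun z => groupCohomology.π (coeffRep G M) n
      (groupCohomology.cocyclesMk (A := coeffRep G M) z.1 z.2))
    (by
      intro a b
      rw [← map_add]
      congr 1
      apply (ModuleCat.mono_iff_injective
        (groupCohomology.iCocycles (coeffRep G M) n)).1 inferInstance
      rw [map_add]
      erw [groupCohomology.iCocycles_mk, groupCohomology.iCocycles_mk,
        groupCohomology.iCocycles_mk]
      rfl)

theorem cocyclesToCohomology_eq_zero (n : ℕ) (z : cocycles G M n)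
    (hz : (z : (Fin n → G) → M) ∈ coboundaries G M n) : cocyclesToCohomology G M n z = 0 := by
  cases n with
  | zero =>
    have : z = 0 := Subtype.ext hz
    rw [this, map_zero]
  | succ n =>
    obtain ⟨z, hz'⟩ := z
    obtain ⟨b, rfl⟩ := hz
    have key : groupCohomology.cocyclesMk (A := coeffRep G M) (differential G M n b) hz' =
        (groupCohomology.toCocycles (coeffRep G M) n (n + 1)).hom b := by
      apply (ModuleCat.mono_iff_injective
        (groupCohomology.iCocycles (coeffRep G M) (n + 1))).1 inferInstance
      erw [groupCohomology.iCocycles_mk]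
      have h := congrArg (fun f => f.hom b)
        ((groupCohomology.inhomogeneousCochains (coeffRep G M)).toCycles_i n (n + 1))
      have h' := congrArg (fun f => f.hom b)
        (groupCohomology.inhomogeneousCochains.d_def (coeffRep G M) n)
      exact (h.trans h').symm
    have h0 := congrArg (fun f => f.hom b)
      ((groupCohomology.inhomogeneousCochains (coeffRep G M)).toCycles_comp_homologyπ n (n + 1))
    change groupCohomology.π (coeffRep G M) (n + 1)
      (groupCohomology.cocyclesMk (A := coeffRep G M) (differential G M n b) hz') = 0
    rw [key]
    exact h0

/-- The canonical map `Hⁿ_cpt(G, M) → Hⁿ(G, M)`, `z + Bⁿ_cpt(G, M) ↦ z + Bⁿ(G, M)`. -/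
def cptToCohomology (n : ℕ) : CptCohomology G M n →+ Cohomology G M n :=
  QuotientAddGroup.lift _
    ((cocyclesToCohomology G M n).comp (AddSubgroup.inclusion inf_le_right))
    (fun _ hz => cocyclesToCohomology_eq_zero G M n _
      ((AddSubgroup.mem_addSubgroupOf.1 hz).2))

variable {G M}

theorem differential_two_apply (c : (Fin 2 → G) → M) (x : Fin 3 → G) :
    differential G M 2 c x = x 0 • c ![x 1, x 2] - c ![x 0 * x 1, x 2] + c ![x 0, x 1 * x 2]
      - c ![x 0, x 1] := by
  rw [differential_apply, Fin.sum_univ_three]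
  have h0 : (fun i : Fin 2 => x i.succ) = ![x 1, x 2] := by
    ext i; fin_cases i <;> rfl
  have h1 : Fin.contractNth (0 : Fin 3) (· * ·) x = ![x 0 * x 1, x 2] := by
    ext i; fin_cases i <;> rfl
  have h2 : Fin.contractNth (1 : Fin 3) (· * ·) x = ![x 0, x 1 * x 2] := by
    ext i; fin_cases i <;> rfl
  have h3 : Fin.contractNth (2 : Fin 3) (· * ·) x = ![x 0, x 1] := by
    ext i; fin_cases i <;> rfl
  rw [h0, h1, h2, h3]
  simp
  abel

theorem differential_three_apply (c : (Fin 3 → G) → M) (x : Fin 4 → G) :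
    differential G M 3 c x = x 0 • c ![x 1, x 2, x 3] - c ![x 0 * x 1, x 2, x 3]
      + c ![x 0, x 1 * x 2, x 3] - c ![x 0, x 1, x 2 * x 3] + c ![x 0, x 1, x 2] := by
  rw [differential_apply, Fin.sum_univ_four]
  have h0 : (fun i : Fin 3 => x i.succ) = ![x 1, x 2, x 3] := by
    ext i; fin_cases i <;> rfl
  have h1 : Fin.contractNth (0 : Fin 4) (· * ·) x = ![x 0 * x 1, x 2, x 3] := by
    ext i; fin_cases i <;> rfl
  have h2 : Fin.contractNth (1 : Fin 4) (· * ·) x = ![x 0, x 1 * x 2, x 3] := by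
    ext i; fin_cases i <;> rfl
  have h3 : Fin.contractNth (2 : Fin 4) (· * ·) x = ![x 0, x 1, x 2 * x 3] := by
    ext i; fin_cases i <;> rfl
  have h4 : Fin.contractNth (3 : Fin 4) (· * ·) x = ![x 0, x 1, x 2] := by
    ext i; fin_cases i <;> rfl
  rw [h0, h1, h2, h3, h4]
  simp [pow_succ]
  abel

theorem cocycle_identity {z : (Fin 3 → G) → M} (hz : z ∈ cptCocycles G M 3) (l k h g : G) :
    l • z ![k, h, g] - z ![l * k, h, g] + z ![l, k * h, g] - z ![l, k, h * g]
      + z ![l, k, h] = 0 := by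
  have h1 := congrFun (show differential G M 3 z = 0 from hz.2) ![l, k, h, g]
  rw [differential_three_apply] at h1
  exact h1

theorem exists_cpt_of_mem_cptCoboundaries {b : (Fin 3 → G) → M}
    (hb : b ∈ cptCoboundaries G M 3) :
    ∃ c ∈ cptCochains G M 2, differential G M 2 c = b := by
  obtain ⟨hp, c, rfl⟩ := hb
  have hl : ∀ g : G, c ![1, g] = c ![1, 1] := by
    intro g
    have h1 := hp ![1, 1, g] ⟨0, rfl⟩
    rw [differential_two_apply] at h1
    simp at h1
    exact sub_eq_zero.1 h1
  have hr : ∀ g : G, c ![g, 1] = g • c ![1, 1] := by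
    intro g
    have h1 := hp ![g, 1, 1] ⟨1, rfl⟩
    rw [differential_two_apply] at h1
    simp at h1
    exact (sub_eq_zero.1 h1).symm
  refine ⟨fun x => c x - x 0 • c ![1, 1], ?_, ?_⟩
  · rintro x ⟨i, hi⟩
    have hx : x = ![x 0, x 1] := by ext j; fin_cases j <;> rfl
    fin_cases i
    · change x 0 = 1 at hi
      have h1 : c x = c ![1, x 1] := by rw [← hi]; exact congrArg c hx
      change c x - x 0 • c ![1, 1] = 0
      rw [h1, hl, hi, one_smul, sub_self]
    · change x 1 = 1 at hi
      have h1 : c x = c ![x 0, 1] := by rw [← hi]; exact congrArg c hx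
      change c x - x 0 • c ![1, 1] = 0
      rw [h1, hr, sub_self]
  · funext x
    rw [differential_two_apply, differential_two_apply]
    simp [smul_sub, mul_smul]
    abel

end Cohomology

/-! ## Crossed modules and crossed module extensions -/

/-- A crossed module: a group `gp` (the group part), a `gp`-module `mp` (the module part, a not
necessarily abelian group on which `gp` acts by automorphisms) and a homomorphism
`struct : mp →* gp` (the structure morphism) that is equivariant and satisfies the Peiffer
identity. -/
structure CrossedModule where
  gp : Type u
  mp : Type u
  [groupGp : Group gp]
  [groupMp : Group mp]
  [action : MulDistribMulAction gp mp]
  struct : mp →* gp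
  equivariance : ∀ (g : gp) (m : mp), struct (g • m) = g * struct m * g⁻¹
  peiffer : ∀ n m : mp, struct n • m = n * m * n⁻¹

attribute [instance] CrossedModule.groupGp CrossedModule.groupMp CrossedModule.action

/-- A morphism of crossed modules. -/
structure CrossedModule.Hom (V W : CrossedModule.{u}) where
  gpHom : V.gp →* W.gp
  mpHom : V.mp →* W.mp
  comm : ∀ m : V.mp, W.struct (mpHom m) = gpHom (V.struct m)
  map_smul : ∀ (g : V.gp) (m : V.mp), mpHom (g • m) = gpHom g • mpHom m

section GroupAux

variable {H : Type u} [Group H] {A B C D a b d e f p q r t w y c v s x : H}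

theorem group_aux₁ (hA : ∀ x, A * x = x * A) (hB : ∀ x, B * x = x * B)
    (h : p * q = B * r * t) : p * (A * w * q) = A * B * (p * w * p⁻¹ * r * t) := by
  have h' : r * t = B⁻¹ * (p * q) := by rw [h]; group
  calc p * (A * w * q) = A * (p * w * q) := by rw [← mul_assoc, ← mul_assoc, ← hA]; group
    _ = A * (B * (p * w * p⁻¹)) * (r * t) := by rw [hB, h']; group
    _ = _ := by group

theorem group_aux₂ (hD : ∀ x, D * x = x * D) (h₁ : p * b = C * a * d)
    (h₂ : d * e = D * f * t) (h₃ : a * f = A * y * r) :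
    p * b * e = C * D * A * (y * r * t) := by
  calc p * b * e = C * (a * D) * f * t := by rw [h₁, mul_assoc _ d, h₂]; group
    _ = C * D * (a * f) * t := by rw [← hD]; group
    _ = _ := by rw [h₃]; group

theorem group_aux₃ (hA : ∀ x, A * x = x * A) (hB : ∀ x, B * x = x * B)
    (hC : ∀ x, C * x = x * C) (h : p * q = c * w * r) :
    A * p * (B * q) = c * (A * B / C / D) * (D * w) * (C * r) := by
  have h1 : A * p * (B * q) = A * B * (p * q) := by rw [mul_assoc A p, ← mul_assoc p, ← hB]; group
  have h2 : c * (A * B / C / D) * (D * w) * (C * r) = A * B * c * w * r := by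
    have h3 : c * (A * B) = A * B * c := by rw [← mul_assoc, ← hA, mul_assoc, ← hB, ← mul_assoc]
    have h4 : c * (A * B / C / D) * (D * w) * (C * r) = c * (A * B) * C⁻¹ * (w * C) * r := by
      rw [div_eq_mul_inv, div_eq_mul_inv]; group
    rw [h4, ← hC, h3]; group
  rw [h1, h2, h]; group

theorem group_aux₄ (hc : ∀ x, c * x = x * c) (h : p * q = c * w * r) :
    e * a * p * s⁻¹ * (s * t * q * v⁻¹) =
      c * (e * (a * (p * t * p⁻¹) * w * x⁻¹) * e⁻¹) * (e * x * r * v⁻¹) := by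
  have h' : w * r = c⁻¹ * (p * q) := by rw [h]; group
  have h1 : c * (e * (a * (p * t * p⁻¹) * w * x⁻¹) * e⁻¹) * (e * x * r * v⁻¹) =
      c * (e * a * p * t * p⁻¹) * (w * r) * v⁻¹ := by group
  rw [h1, hc, h']; group

end GroupAux

section Extensions

variable (G M : Type u) [Group G] [AddCommGroup M] [DistribMulAction G M]

/-- A crossed module extension of `G` with `M`: a crossed module together with a monomorphism
`ι : M → mp` and an epimorphism `π : gp → G` such that `M → mp → gp → G` is exact and such that the
induced action of `G` on `M` is the given one. The additive group `M` is written multiplicatively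
where it meets the other groups. -/
structure Extension extends CrossedModule.{u} where
  ι : Multiplicative M →* mp
  π : gp →* G
  ι_injective : Function.Injective ι
  π_surjective : Function.Surjective π
  exact_mp : ι.range = struct.ker
  exact_gp : struct.range = π.ker
  ι_smul : ∀ (e : gp) (m : M),
    e • ι (Multiplicative.ofAdd m) = ι (Multiplicative.ofAdd (π e • m))

variable {G M}

/-- An extension equivalence: a morphism of the underlying crossed modules that is compatible with
the canonical monomorphisms and the canonical epimorphisms. -/
structure Extension.Equivalence (E E' : Extension G M) extends
    CrossedModule.Hom E.toCrossedModule E'.toCrossedModule where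
  mpHom_ι : ∀ m : Multiplicative M, mpHom (E.ι m) = E'.ι m
  π_gpHom : ∀ e : E.gp, E'.π (gpHom e) = E.π e

variable (G M)

/-- The equivalence relation on crossed module extensions generated by the existence of an extension
equivalence. -/
def extensionSetoid : Setoid (Extension G M) :=
  Relation.EqvGen.setoid fun E E' => Nonempty (Extension.Equivalence E E')

/-- The set `Ext²(G, M)` of crossed module extension classes. -/
def ExtensionClass : Type (u + 1) :=
  Quotient (extensionSetoid G M)

variable {G M}

/-- The class of a crossed module extension. -/
def Extension.toClass (E : Extension G M) : ExtensionClass G M :=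
  Quotient.mk (extensionSetoid G M) E

theorem Extension.toClass_eq {E E' : Extension G M} (φ : Extension.Equivalence E E') :
    E.toClass = E'.toClass :=
  Quotient.sound (s := extensionSetoid G M) (Relation.EqvGen.rel _ _ ⟨φ⟩)

variable (G M) in
/-- The trivial crossed module extension `M = M → G = G`, whose structure morphism is the trivial
homomorphism. -/
def trivialExtension : Extension G M :=
  letI act : MulDistribMulAction G (Multiplicative M) :=
    { smul := fun g m => Multiplicative.ofAdd (g • Multiplicative.toAdd m)
      one_smul := fun m => one_smul G (Multiplicative.toAdd m)
      mul_smul := fun g h m => mul_smul g h (Multiplicative.toAdd m)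
      smul_mul := fun g m n => smul_add g (Multiplicative.toAdd m) (Multiplicative.toAdd n)
      smul_one := fun g => smul_zero (A := M) g }
  { gp := G
    mp := Multiplicative M
    action := act
    struct := 1
    equivariance := fun g _ => by simp
    peiffer := fun n m => by
      rw [MonoidHom.one_apply, one_smul, mul_comm n m, mul_inv_cancel_right]
    ι := MonoidHom.id _
    π := MonoidHom.id _
    ι_injective := fun _ _ h => h
    π_surjective := fun g => ⟨g, rfl⟩
    exact_mp := by ext m; simp
    exact_gp := by ext g; simp
    ι_smul := fun _ _ => rfl }

/-! ## Lifting systems and the associated cohomology class -/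

/-- The non-abelian `2`-cocycle `(h, g) ↦ s(h) s(g) s(hg)⁻¹` with respect to a map `s`. -/
def nonabelianCocycle {G E₀ : Type u} [Group G] [Group E₀] (s : G → E₀) (h g : G) : E₀ :=
  s h * s g * (s (h * g))⁻¹

namespace Extension

variable (E : Extension G M)

theorem struct_ι (m : Multiplicative M) : E.struct (E.ι m) = 1 := by
  have h : E.ι m ∈ E.struct.ker := by rw [← E.exact_mp]; exact ⟨m, rfl⟩
  exact h

theorem ι_comm (m : Multiplicative M) (x : E.mp) : E.ι m * x = x * E.ι m := by
  have h := E.peiffer (E.ι m) x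
  rw [struct_ι, one_smul] at h
  exact (eq_mul_inv_iff_mul_eq.1 h).symm

/-- A lifting system for `E`: a pointed section `Z₁` of the canonical epimorphism and a
componentwise pointed lift `Z₂` of the non-abelian `2`-cocycle of `Z₁` along the structure
morphism. -/
structure LiftingSystem where
  Z₁ : G → E.gp
  Z₂ : G → G → E.mp
  Z₁_one : Z₁ 1 = 1
  π_Z₁ : ∀ g, E.π (Z₁ g) = g
  struct_Z₂ : ∀ h g, E.struct (Z₂ h g) = nonabelianCocycle Z₁ h g
  Z₂_one_left : ∀ g, Z₂ 1 g = 1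
  Z₂_one_right : ∀ h, Z₂ h 1 = 1

theorem exists_struct_eq {e : E.gp} (he : E.π e = 1) : ∃ m, E.struct m = e := by
  have h : e ∈ E.struct.range := by rw [E.exact_gp]; exact he
  exact h

theorem exists_liftingSystem : Nonempty E.LiftingSystem := by
  classical
  choose s hs using E.π_surjective
  have hp : ∀ g, E.π (if g = 1 then 1 else s g) = g := by
    intro g
    split_ifs with hg
    · rw [map_one, hg]
    · exact hs g
  have ht : ∀ h g, ∃ m, E.struct m =
      nonabelianCocycle (fun g => if g = 1 then 1 else s g) h g := by
    intro h g
    apply E.exists_struct_eq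
    simp only [nonabelianCocycle, map_mul, map_inv, hp, mul_inv_cancel]
  choose t ht using ht
  refine ⟨⟨fun g => if g = 1 then 1 else s g, fun h g => if h = 1 ∨ g = 1 then 1 else t h g,
    if_pos rfl, hp, fun h g => ?_, fun g => if_pos (Or.inl rfl), fun h => if_pos (Or.inr rfl)⟩⟩
  split_ifs with hhg
  · rw [map_one]
    rcases hhg with rfl | rfl <;> simp [nonabelianCocycle]
  · exact ht h g

variable {E}

namespace LiftingSystem

variable (Z : E.LiftingSystem)

theorem struct_mul (h g : G) : E.struct (Z.Z₂ h g) * Z.Z₁ (h * g) = Z.Z₁ h * Z.Z₁ g := by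
  rw [Z.struct_Z₂, nonabelianCocycle, inv_mul_cancel_right]

/-- The element `Z₂(k,h) Z₂(kh,g) Z₂(k,hg)⁻¹ (ᵏZ₂(h,g))⁻¹`, where `k` acts through `Z₁(k)`. -/
def obstruction (k h g : G) : E.mp :=
  Z.Z₂ k h * Z.Z₂ (k * h) g * (Z.Z₂ k (h * g))⁻¹ * (Z.Z₁ k • Z.Z₂ h g)⁻¹

theorem obstruction_mem_range (k h g : G) : Z.obstruction k h g ∈ E.ι.range := by
  rw [E.exact_mp, MonoidHom.mem_ker, obstruction]
  simp only [map_mul, map_inv, E.equivariance, Z.struct_Z₂, nonabelianCocycle, mul_assoc]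
  group

/-- The `3`-cocycle `c³` of `E` with respect to a lifting system:
`c³(k,h,g) = ι⁻¹(Z₂(k,h) Z₂(kh,g) Z₂(k,hg)⁻¹ (ᵏZ₂(h,g))⁻¹)`. -/
def cochain (x : Fin 3 → G) : M :=
  Multiplicative.toAdd
    ((MonoidHom.ofInjective E.ι_injective).symm
      ⟨Z.obstruction (x 0) (x 1) (x 2), Z.obstruction_mem_range (x 0) (x 1) (x 2)⟩)

theorem ι_cochain (x : Fin 3 → G) :
    E.ι (Multiplicative.ofAdd (Z.cochain x)) = Z.obstruction (x 0) (x 1) (x 2) := by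
  have h := (MonoidHom.ofInjective E.ι_injective).apply_symm_apply
    ⟨Z.obstruction (x 0) (x 1) (x 2), Z.obstruction_mem_range (x 0) (x 1) (x 2)⟩
  exact congrArg Subtype.val h

/-- The defining relation of the cocycle. -/
theorem Z₂_mul (k h g : G) : Z.Z₂ k h * Z.Z₂ (k * h) g =
    E.ι (Multiplicative.ofAdd (Z.cochain ![k, h, g])) * (Z.Z₁ k • Z.Z₂ h g) * Z.Z₂ k (h * g) := by
  rw [ι_cochain]
  simp [obstruction]

theorem eq_cochain {k h g : G} {m : M}
    (hm : Z.Z₂ k h * Z.Z₂ (k * h) g =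
      E.ι (Multiplicative.ofAdd m) * (Z.Z₁ k • Z.Z₂ h g) * Z.Z₂ k (h * g)) :
    m = Z.cochain ![k, h, g] := by
  rw [Z₂_mul] at hm
  exact (Multiplicative.ofAdd.injective (E.ι_injective (mul_right_cancel (mul_right_cancel hm)))).symm

theorem Z₁_smul_smul (l k : G) (x : E.mp) :
    Z.Z₁ l • Z.Z₁ k • x = Z.Z₂ l k * (Z.Z₁ (l * k) • x) * (Z.Z₂ l k)⁻¹ := by
  rw [← mul_smul, ← struct_mul, mul_smul, E.peiffer]

theorem cochain_mem : Z.cochain ∈ cptCocycles G M 3 := by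
  constructor
  · rintro x ⟨i, hi⟩
    apply Multiplicative.ofAdd.injective
    apply E.ι_injective
    rw [ι_cochain, obstruction, ofAdd_zero, map_one]
    fin_cases i <;> simp only [Fin.zero_eta, Fin.mk_one, Fin.reduceFinMk] at hi <;>
      simp [hi, Z.Z₁_one, Z.Z₂_one_left, Z.Z₂_one_right]
  · change differential G M 3 Z.cochain = 0
    funext x
    obtain ⟨l, k, h, g, rfl⟩ : ∃ l k h g : G, x = ![l, k, h, g] :=
      ⟨x 0, x 1, x 2, x 3, by ext i; fin_cases i <;> rfl⟩
    rw [differential_three_apply]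
    change l • Z.cochain ![k, h, g] - Z.cochain ![l * k, h, g] + Z.cochain ![l, k * h, g]
      - Z.cochain ![l, k, h * g] + Z.cochain ![l, k, h] = 0
    have e1 : Z.Z₂ l k * Z.Z₂ (l * k) h * Z.Z₂ (l * k * h) g =
        E.ι (Multiplicative.ofAdd (Z.cochain ![l * k, h, g] + Z.cochain ![l, k, h * g])) *
          ((Z.Z₁ l • Z.Z₁ k • Z.Z₂ h g) * (Z.Z₁ l • Z.Z₂ k (h * g)) * Z.Z₂ l (k * (h * g))) := by
      have e := Z.Z₂_mul l k (h * g)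
      rw [mul_assoc, Z₂_mul, Z₁_smul_smul, ofAdd_add, map_mul]
      exact group_aux₁ (E.ι_comm _) (E.ι_comm _) e
    have e2 : Z.Z₂ l k * Z.Z₂ (l * k) h * Z.Z₂ (l * k * h) g =
        E.ι (Multiplicative.ofAdd (Z.cochain ![l, k, h] + Z.cochain ![l, k * h, g]
          + l • Z.cochain ![k, h, g])) *
          ((Z.Z₁ l • Z.Z₁ k • Z.Z₂ h g) * (Z.Z₁ l • Z.Z₂ k (h * g)) * Z.Z₂ l (k * (h * g))) := by
      rw [ofAdd_add, ofAdd_add, map_mul, map_mul]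
      have e := Z.Z₂_mul l (k * h) g
      have e' := congrArg (Z.Z₁ l • ·) (Z.Z₂_mul k h g)
      simp only [smul_mul', E.ι_smul, Z.π_Z₁] at e'
      rw [← mul_assoc l k h, mul_assoc k h g] at e
      exact group_aux₂ (E.ι_comm _) (Z.Z₂_mul l k h) e e'
    rw [e1] at e2
    have e3 := Multiplicative.ofAdd.injective (E.ι_injective (mul_right_cancel e2))
    rw [← sub_eq_zero.2 e3.symm]
    abel

/-- The cohomology class of the `3`-cocycle of `E` with respect to a lifting system. -/
def cohomologyClass : CptCohomology G M 3 :=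
  cptClass G M ⟨Z.cochain, Z.cochain_mem⟩

theorem cohomologyClass_eq_of_sub {E' : Extension G M} {Z' : E'.LiftingSystem}
    (c : (Fin 2 → G) → M)
    (h : ∀ k h g, Z.cochain ![k, h, g] = Z'.cochain ![k, h, g] + (c ![k, h] + c ![k * h, g]
      - c ![k, h * g] - k • c ![h, g])) : Z.cohomologyClass = Z'.cohomologyClass := by
  refine QuotientAddGroup.eq.2 (AddSubgroup.mem_addSubgroupOf.2 ⟨?_, c, ?_⟩)
  · exact (cptCochains G M 3).add_mem ((cptCochains G M 3).neg_mem Z.cochain_mem.1)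
      Z'.cochain_mem.1
  · funext x
    rw [differential_two_apply]
    change _ = -Z.cochain x + Z'.cochain x
    have hx : x = ![x 0, x 1, x 2] := by ext i; fin_cases i <;> rfl
    rw [hx, h]
    simp
    abel

/-- Independence of the choice of `Z₂`. -/
theorem cohomologyClass_eq_of_Z₁_eq (Z' : E.LiftingSystem) (hZ : Z'.Z₁ = Z.Z₁) :
    Z'.cohomologyClass = Z.cohomologyClass := by
  have hb : ∀ h g, ∃ b : M, E.ι (Multiplicative.ofAdd b) * Z.Z₂ h g = Z'.Z₂ h g := by
    intro h g
    have hm : Z'.Z₂ h g * (Z.Z₂ h g)⁻¹ ∈ E.ι.range := by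
      rw [E.exact_mp, MonoidHom.mem_ker, map_mul, map_inv, Z.struct_Z₂, Z'.struct_Z₂, hZ,
        mul_inv_cancel]
    obtain ⟨b, hb⟩ := hm
    refine ⟨Multiplicative.toAdd b, ?_⟩
    rw [ofAdd_toAdd, hb, inv_mul_cancel_right]
  choose b hb using hb
  refine cohomologyClass_eq_of_sub _ (fun x => b (x 0) (x 1)) fun k h g => ?_
  symm
  apply Z'.eq_cochain
  rw [hZ, ← hb, ← hb, ← hb, ← hb, smul_mul', E.ι_smul, Z.π_Z₁]
  have e := Z.Z₂_mul k h g
  simp only [ofAdd_add, ofAdd_sub, map_mul, map_div]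
  exact group_aux₃ (E.ι_comm _) (E.ι_comm _) (E.ι_comm _) e

/-- The cohomology class does not depend on the lifting system. -/
theorem cohomologyClass_eq (Z' Z : E.LiftingSystem) :
    Z'.cohomologyClass = Z.cohomologyClass := by
  classical
  have hc : ∀ g, ∃ c : E.mp, E.struct c = Z'.Z₁ g * (Z.Z₁ g)⁻¹ ∧ (g = 1 → c = 1) := by
    intro g
    by_cases hg : g = 1
    · refine ⟨1, ?_, fun _ => rfl⟩
      rw [hg, Z.Z₁_one, Z'.Z₁_one, map_one, inv_one, mul_one]
    · obtain ⟨c, hc⟩ := E.exists_struct_eq (e := Z'.Z₁ g * (Z.Z₁ g)⁻¹)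
        (by rw [map_mul, map_inv, Z.π_Z₁, Z'.π_Z₁, mul_inv_cancel])
      exact ⟨c, hc, fun h => absurd h hg⟩
  choose c hc hc1 using hc
  have hc1 := hc1 1 rfl
  have hZ' : ∀ g, Z'.Z₁ g = E.struct (c g) * Z.Z₁ g := by
    intro g; rw [hc, inv_mul_cancel_right]
  let Y : E.LiftingSystem :=
    { Z₁ := Z'.Z₁
      Z₂ := fun h g => c h * (Z.Z₁ h • c g) * Z.Z₂ h g * (c (h * g))⁻¹
      Z₁_one := Z'.Z₁_one
      π_Z₁ := Z'.π_Z₁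
      struct_Z₂ := fun h g => by
        simp only [map_mul, map_inv, E.equivariance, Z.struct_Z₂, hc, nonabelianCocycle]
        group
      Z₂_one_left := fun g => by simp [hc1, Z.Z₁_one, Z.Z₂_one_left]
      Z₂_one_right := fun h => by simp [hc1, Z.Z₂_one_right] }
  rw [Y.cohomologyClass_eq_of_Z₁_eq Z' rfl]
  refine cohomologyClass_eq_of_sub _ 0 fun k h g => ?_
  simp only [Pi.zero_apply, smul_zero, sub_zero, add_zero]
  symm
  apply Y.eq_cochain
  change c k * (Z.Z₁ k • c h) * Z.Z₂ k h * (c (k * h))⁻¹ *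
      (c (k * h) * (Z.Z₁ (k * h) • c g) * Z.Z₂ (k * h) g * (c (k * h * g))⁻¹) =
    _ * (Z'.Z₁ k • (c h * (Z.Z₁ h • c g) * Z.Z₂ h g * (c (h * g))⁻¹)) *
      (c k * (Z.Z₁ k • c (h * g)) * Z.Z₂ k (h * g) * (c (k * (h * g)))⁻¹)
  rw [hZ', mul_smul, E.peiffer]
  simp only [smul_mul', smul_inv', Z₁_smul_smul]
  rw [mul_assoc k h g]
  exact group_aux₄ (E.ι_comm _) (Z.Z₂_mul k h g)

/-- The image of a lifting system under an extension equivalence. -/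
def map {E' : Extension G M} (φ : E.Equivalence E') : E'.LiftingSystem where
  Z₁ g := φ.gpHom (Z.Z₁ g)
  Z₂ h g := φ.mpHom (Z.Z₂ h g)
  Z₁_one := by rw [Z.Z₁_one, map_one]
  π_Z₁ g := by rw [φ.π_gpHom, Z.π_Z₁]
  struct_Z₂ h g := by
    rw [φ.comm, Z.struct_Z₂]
    simp only [nonabelianCocycle, map_mul, map_inv]
  Z₂_one_left g := by rw [Z.Z₂_one_left, map_one]
  Z₂_one_right h := by rw [Z.Z₂_one_right, map_one]

theorem cohomologyClass_map {E' : Extension G M} (φ : E.Equivalence E') :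
    (Z.map φ).cohomologyClass = Z.cohomologyClass := by
  refine cohomologyClass_eq_of_sub _ 0 fun k h g => ?_
  simp only [Pi.zero_apply, smul_zero, sub_zero, add_zero]
  symm
  apply (Z.map φ).eq_cochain
  have e := congrArg φ.mpHom (Z.Z₂_mul k h g)
  simp only [map_mul, φ.map_smul, φ.mpHom_ι] at e
  exact e

end LiftingSystem

/-- The cohomology class associated to a crossed module extension: the class of its `3`-cocycle with
respect to an arbitrarily chosen lifting system. -/
def cohomologyClass (E : Extension G M) : CptCohomology G M 3 :=
  (Classical.choice E.exists_liftingSystem).cohomologyClass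

theorem cohomologyClass_eq_of_equivalence {E E' : Extension G M} (φ : E.Equivalence E') :
    E.cohomologyClass = E'.cohomologyClass := by
  rw [cohomologyClass, ← LiftingSystem.cohomologyClass_map _ φ]
  exact LiftingSystem.cohomologyClass_eq _ _

end Extension

variable (G M) in
/-- The map `cl : Ext²(G, M) → H³_cpt(G, M)` that sends the class of a crossed module extension to
its associated cohomology class. -/
def classOfExtension : ExtensionClass G M → CptCohomology G M 3 :=
  Quotient.lift Extension.cohomologyClass fun E E' h => by
    induction h with
    | rel _ _ h => exact Extension.cohomologyClass_eq_of_equivalence h.some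
    | refl _ => rfl
    | symm _ _ _ ih => exact ih.symm
    | trans _ _ _ _ _ ih₁ ih₂ => exact ih₁.trans ih₂

end Extensions

/-! ## The standard extension -/

section Standard

variable (G M : Type u) [Group G] [AddCommGroup M] [DistribMulAction G M]

/-- A free group `F` on the pointed set `(G, 1)`. -/
abbrev StdGroup : Type u :=
  FreeGroup {g : G // g ≠ 1}

/-- The canonical epimorphism `π : F → G` extending the identity of `G`. -/
def stdπ : StdGroup G →* G :=
  FreeGroup.lift Subtype.val

variable {G}

open Classical in
/-- The basis `s⁰ : G → F` of the free group on the pointed set `(G, 1)`. -/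
def stdBasis (g : G) : StdGroup G :=
  if h : g = 1 then 1 else FreeGroup.of ⟨g, h⟩

theorem stdBasis_one : stdBasis (1 : G) = 1 :=
  dif_pos rfl

theorem stdBasis_coe (g : {g : G // g ≠ 1}) : stdBasis g.1 = FreeGroup.of g :=
  dif_neg g.2

theorem stdπ_of (g : {g : G // g ≠ 1}) : stdπ G (FreeGroup.of g) = g.1 :=
  FreeGroup.lift_apply_of

theorem stdπ_basis (g : G) : stdπ G (stdBasis g) = g := by
  by_cases h : g = 1
  · rw [h, stdBasis_one, map_one]
  · exact (congrArg (stdπ G) (stdBasis_coe ⟨g, h⟩)).trans (stdπ_of ⟨g, h⟩)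

/-- The non-abelian `2`-cocycle `(h, g) ↦ s⁰(h) s⁰(g) s⁰(hg)⁻¹` of `F`, with values in `Ker π`. -/
def stdCocycle (h g : G) : (stdπ G).ker :=
  ⟨nonabelianCocycle stdBasis h g, by
    rw [MonoidHom.mem_ker]
    simp only [nonabelianCocycle, map_mul, map_inv, stdπ_basis, mul_inv_cancel]⟩

theorem stdCocycle_mul (h g : G) :
    (stdCocycle h g : StdGroup G) * stdBasis (h * g) = stdBasis h * stdBasis g := by
  exact inv_mul_cancel_right _ _

theorem conj_stdCocycle (k h g : G) :
    MulAut.conjNormal (stdBasis k) (stdCocycle h g) =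
      stdCocycle k h * stdCocycle (k * h) g * (stdCocycle k (h * g))⁻¹ := by
  apply Subtype.ext
  rw [MulAut.conjNormal_apply]
  simp only [stdCocycle, nonabelianCocycle, Subgroup.coe_mul, Subgroup.coe_inv, mul_assoc k h g]
  group

/-- `Ker π` is generated by the values of its non-abelian `2`-cocycle. -/
theorem closure_stdCocycle :
    Subgroup.closure {r : (stdπ G).ker | ∃ h g, stdCocycle h g = r} = ⊤ := by
  set K := Subgroup.closure {r : (stdπ G).ker | ∃ h g, stdCocycle h g = r} with hK
  have hmem : ∀ h g, stdCocycle h g ∈ K := fun h g => Subgroup.subset_closure ⟨h, g, rfl⟩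
  have key : ∀ w : StdGroup G, ∀ g : G, ∃ n ∈ K,
      stdBasis g * w = (n : StdGroup G) * stdBasis (g * stdπ G w) := by
    intro w
    induction w using FreeGroup.induction_on with
    | C1 => exact fun g => ⟨1, K.one_mem, by simp⟩
    | of k =>
      intro g
      refine ⟨stdCocycle g k.1, hmem _ _, ?_⟩
      change _ * FreeGroup.of k = _ * stdBasis (g * stdπ G (FreeGroup.of k))
      rw [stdπ_of, stdCocycle_mul, stdBasis_coe]
    | inv_of k _ =>
      intro g
      refine ⟨(stdCocycle (g * k.1⁻¹) k.1)⁻¹, K.inv_mem (hmem _ _), ?_⟩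
      change _ * (FreeGroup.of k)⁻¹ = _ * stdBasis (g * stdπ G (FreeGroup.of k)⁻¹)
      rw [map_inv, stdπ_of, Subgroup.coe_inv, eq_inv_mul_iff_mul_eq, ← mul_assoc,
        mul_inv_eq_iff_eq_mul, ← stdBasis_coe, ← stdCocycle_mul, inv_mul_cancel_right]
    | mul v w hv hw =>
      intro g
      obtain ⟨n, hn, h1⟩ := hv g
      obtain ⟨n', hn', h2⟩ := hw (g * stdπ G v)
      refine ⟨n * n', K.mul_mem hn hn', ?_⟩
      rw [← mul_assoc, h1, mul_assoc, h2, map_mul, Subgroup.coe_mul]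
      simp only [mul_assoc]
  rw [eq_top_iff]
  rintro ⟨w, hw⟩ -
  obtain ⟨n, hn, h⟩ := key w 1
  rw [(hw : stdπ G w = 1), mul_one, stdBasis_one, one_mul, mul_one] at h
  have : (⟨w, hw⟩ : (stdπ G).ker) = n := Subtype.ext h
  rwa [this]

theorem kerHom_ext {H : Type*} [Group H] {f f' : (stdπ G).ker →* H}
    (h : ∀ k g, f (stdCocycle k g) = f' (stdCocycle k g)) : f = f' :=
  MonoidHom.eq_of_eqOn_dense closure_stdCocycle (by rintro _ ⟨k, g, rfl⟩; exact h k g)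

section Twist

variable {M : Type u} [AddCommGroup M]

/-- The action of `G` on maps `G → M` by translation, `(a • f)(x) = f(xa)`. -/
def shift (G M : Type u) [Group G] [AddCommGroup M] :
    G →* MulAut (G → Multiplicative M) where
  toFun a :=
    { toFun := fun f x => f (x * a)
      invFun := fun f x => f (x * a⁻¹)
      left_inv := fun f => by funext x; simp
      right_inv := fun f => by funext x; simp
      map_mul' := fun _ _ => rfl }
  map_one' := by ext f x; simp
  map_mul' a b := by ext f x; simp [mul_assoc]

/-- The homomorphism from `F` to the semidirect product of `Map(G, M)` and `G` that sends a free
generator `g` to `(φ(-, g), g)`. -/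
def twist (φ : G → G → M) : StdGroup G →* (G → Multiplicative M) ⋊[shift G M] G :=
  FreeGroup.lift fun g => ⟨fun x => Multiplicative.ofAdd (φ x g.1), g.1⟩

theorem twist_right (φ : G → G → M) (w : StdGroup G) : (twist φ w).right = stdπ G w := by
  have h : (SemidirectProduct.rightHom).comp (twist φ) = stdπ G := by
    apply FreeGroup.ext_hom
    intro g
    rw [stdπ_of, MonoidHom.comp_apply, twist, FreeGroup.lift_apply_of]
    rfl
  exact DFunLike.congr_fun h w

theorem twist_basis (φ : G → G → M) (hφ : ∀ h, φ h 1 = 0) (g : G) :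
    (twist φ (stdBasis g)).left = fun x => Multiplicative.ofAdd (φ x g) := by
  by_cases h : g = 1
  · rw [h, stdBasis_one, map_one]
    funext x
    rw [hφ]
    rfl
  · rw [show stdBasis g = FreeGroup.of ⟨g, h⟩ from stdBasis_coe ⟨g, h⟩, twist,
      FreeGroup.lift_apply_of]

/-- The homomorphism `Ker π → M` that sends `(h, g)` under the non-abelian `2`-cocycle to `φ(h, g)`,
for a componentwise pointed map `φ : G × G → M`; see `kerHom_stdCocycle`. -/
def kerHom (φ : G → G → M) : (stdπ G).ker →* Multiplicative M where
  toFun r := (twist φ r).left 1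
  map_one' := by rw [Subgroup.coe_one, map_one]; rfl
  map_mul' r s := by
    rw [Subgroup.coe_mul, map_mul, SemidirectProduct.mul_left, twist_right, (r.2 : stdπ G r = 1),
      map_one]
    rfl

theorem kerHom_stdCocycle {φ : G → G → M} (h₁ : ∀ g, φ 1 g = 0) (h₂ : ∀ h, φ h 1 = 0) (h g : G) :
    kerHom φ (stdCocycle h g) = Multiplicative.ofAdd (φ h g) := by
  have e := congrArg (fun w => (twist φ w).left 1) (stdCocycle_mul h g)
  have hr : stdπ G (stdCocycle h g) = 1 := (stdCocycle h g).2
  simp only [map_mul, SemidirectProduct.mul_left, twist_right, stdπ_basis, twist_basis φ h₂,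
    Pi.mul_apply] at e
  change kerHom φ (stdCocycle h g) * Multiplicative.ofAdd (φ (1 * stdπ G (stdCocycle h g)) (h * g))
    = Multiplicative.ofAdd (φ 1 h) * Multiplicative.ofAdd (φ (1 * h) g) at e
  rw [hr, one_mul, one_mul, h₁, h₁, ofAdd_zero, mul_one, one_mul] at e
  exact e

end Twist

variable (G) in
/-- The module part `M × Ker π` of the standard extension. -/
abbrev StdModule : Type u :=
  Multiplicative M × (stdπ G).ker

variable {M}

/-- The automorphism by which `s⁰(k)` acts on `M × Ker π`: it sends `m` to `km` and the value of the
non-abelian `2`-cocycle at `(h, g)` to `-z(k,h,g)` times its conjugate by `s⁰(k)`. -/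
def stdAut (z : (Fin 3 → G) → M) (k : G) : MulAut (StdModule G M) where
  toFun x :=
    (Multiplicative.ofAdd (k • Multiplicative.toAdd x.1) * kerHom (fun h g => -z ![k, h, g]) x.2,
      MulAut.conjNormal (stdBasis k) x.2)
  invFun y :=
    (Multiplicative.ofAdd (k⁻¹ • Multiplicative.toAdd
        (y.1 / kerHom (fun h g => -z ![k, h, g]) ((MulAut.conjNormal (stdBasis k)).symm y.2))),
      (MulAut.conjNormal (stdBasis k)).symm y.2)
  left_inv x := by simp
  right_inv y := by simp
  map_mul' x y := by
    ext
    · simp only [Prod.fst_mul, Prod.snd_mul, toAdd_mul, smul_add, ofAdd_add, map_mul]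
      exact add_add_add_comm _ _ _ _
    · simp

/-- The action of `F` on `M × Ker π`. -/
def stdAction (z : (Fin 3 → G) → M) : StdGroup G →* MulAut (StdModule G M) :=
  FreeGroup.lift fun k => stdAut z k.1

theorem stdAction_of (z : (Fin 3 → G) → M) (k : {g : G // g ≠ 1}) :
    stdAction z (FreeGroup.of k) = stdAut z k.1 :=
  FreeGroup.lift_apply_of

theorem stdAction_snd (z : (Fin 3 → G) → M) (w : StdGroup G) (x : StdModule G M) :
    (stdAction z w x).2 = MulAut.conjNormal w x.2 := by
  induction w using FreeGroup.induction_on generalizing x with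
  | C1 => simp
  | of k =>
    change (stdAction z (FreeGroup.of k) x).2 = MulAut.conjNormal (FreeGroup.of k) x.2
    rw [stdAction_of, ← stdBasis_coe]
    rfl
  | inv_of k ih =>
    have h := ih ((stdAction z (FreeGroup.of k))⁻¹ x)
    change (stdAction z (FreeGroup.of k)⁻¹ x).2 = MulAut.conjNormal (FreeGroup.of k)⁻¹ x.2
    change (stdAction z (FreeGroup.of k) _).2 = MulAut.conjNormal (FreeGroup.of k) _ at h
    rw [MulAut.apply_inv_self] at h
    rw [map_inv, map_inv, h, MulAut.inv_apply_self]
  | mul v w hv hw => rw [map_mul, MulAut.mul_apply, hv, hw, map_mul, MulAut.mul_apply]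

/-- `F` acts on `M` through `π` and the given action of `G`. -/
theorem stdAction_inl (z : (Fin 3 → G) → M) (w : StdGroup G) (m : M) :
    stdAction z w (Multiplicative.ofAdd m, 1) = (Multiplicative.ofAdd (stdπ G w • m), 1) := by
  induction w using FreeGroup.induction_on generalizing m with
  | C1 => simp
  | of k =>
    rw [stdAction_of, stdπ_of]
    simp [stdAut]
  | inv_of k ih =>
    have h := ih (k.1⁻¹ • m)
    change stdAction z (FreeGroup.of k) _ =
      (Multiplicative.ofAdd (stdπ G (FreeGroup.of k) • k.1⁻¹ • m), 1) at h
    change stdAction z (FreeGroup.of k)⁻¹ _ =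
      (Multiplicative.ofAdd (stdπ G (FreeGroup.of k)⁻¹ • m), 1)
    rw [stdπ_of, smul_inv_smul] at h
    rw [map_inv, map_inv, stdπ_of, ← h, MulAut.inv_apply_self]
  | mul v w hv hw => rw [map_mul, MulAut.mul_apply, hw, hv, map_mul, mul_smul]

section Cocycle

variable (z : cptCocycles G M 3)

theorem stdMap_one_left (k g : G) : -(z : (Fin 3 → G) → M) ![k, 1, g] = 0 := by
  rw [z.2.1 _ ⟨1, rfl⟩, neg_zero]

theorem stdMap_one_right (k h : G) : -(z : (Fin 3 → G) → M) ![k, h, 1] = 0 := by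
  rw [z.2.1 _ ⟨2, rfl⟩, neg_zero]

theorem kerHom_cocycle (k h g : G) :
    kerHom (fun h g => -(z : (Fin 3 → G) → M) ![k, h, g]) (stdCocycle h g) =
      Multiplicative.ofAdd (-(z : (Fin 3 → G) → M) ![k, h, g]) :=
  kerHom_stdCocycle (stdMap_one_left z k) (stdMap_one_right z k) h g

theorem stdAction_basis (k : G) : stdAction (z : (Fin 3 → G) → M) (stdBasis k) = stdAut z k := by
  by_cases hk : k = 1
  · have h1 : kerHom (fun h g => -(z : (Fin 3 → G) → M) ![1, h, g]) = 1 := by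
      apply kerHom_ext
      intro h g
      rw [kerHom_cocycle, z.2.1 _ ⟨0, rfl⟩, neg_zero]
      rfl
    rw [hk, stdBasis_one, map_one]
    ext x <;> simp [stdAut, h1, stdBasis_one]
  · exact (congrArg _ (stdBasis_coe ⟨k, hk⟩)).trans (stdAction_of _ ⟨k, hk⟩)

/-- The defining formula for the action on the generators of `Ker π`: the generator `(h, g)` is sent
by `s⁰(k)` to `(-z(k,h,g), (k,h) (kh,g) (k,hg)⁻¹)`. -/
theorem stdAction_stdCocycle (k h g : G) :
    stdAction (z : (Fin 3 → G) → M) (stdBasis k) (1, stdCocycle h g) =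
      (Multiplicative.ofAdd (-(z : (Fin 3 → G) → M) ![k, h, g]),
        stdCocycle k h * stdCocycle (k * h) g * (stdCocycle k (h * g))⁻¹) := by
  rw [stdAction_basis]
  change (_ * kerHom (M := M) _ (stdCocycle h g), MulAut.conjNormal _ _) = _
  rw [kerHom_cocycle, conj_stdCocycle]
  simp

theorem kerHom_conj (l k : G) (r : (stdπ G).ker) :
    l • Multiplicative.toAdd (kerHom (fun h g => -(z : (Fin 3 → G) → M) ![k, h, g]) r) +
      Multiplicative.toAdd (kerHom (fun h g => -(z : (Fin 3 → G) → M) ![l, h, g])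
        (MulAut.conjNormal (stdBasis k) r)) =
      Multiplicative.toAdd (kerHom (fun h g => -(z : (Fin 3 → G) → M) ![l * k, h, g]) r) := by
  have e : (AddMonoidHom.toMultiplicative (DistribSMul.toAddMonoidHom M l)).comp
        (kerHom fun h g => -(z : (Fin 3 → G) → M) ![k, h, g]) *
      (kerHom (fun h g => -(z : (Fin 3 → G) → M) ![l, h, g])).comp
        (MulAut.conjNormal (stdBasis k)).toMonoidHom =
      kerHom (fun h g => -(z : (Fin 3 → G) → M) ![l * k, h, g]) := by
    apply kerHom_ext
    intro h g
    change Multiplicative.ofAdd (l • Multiplicative.toAdd (kerHom (M := M) _ (stdCocycle h g))) *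
      kerHom (M := M) _ (MulAut.conjNormal (stdBasis k) (stdCocycle h g)) = _
    rw [conj_stdCocycle, map_mul, map_mul, map_inv]
    simp only [kerHom_cocycle]
    rw [← ofAdd_neg, ← ofAdd_add, ← ofAdd_add, toAdd_ofAdd, ← ofAdd_add]
    congr 1
    have hz := cocycle_identity z.2 l k h g
    rw [← sub_eq_zero, ← neg_eq_zero, ← hz, smul_neg]
    abel
  exact congrArg Multiplicative.toAdd (DFunLike.congr_fun e r)

theorem stdAction_ker (r : (stdπ G).ker) (x : StdModule G M) :
    stdAction (z : (Fin 3 → G) → M) r x = ((1, r) : StdModule G M) * x * (1, r)⁻¹ := by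
  have e : (stdAction (z : (Fin 3 → G) → M)).comp (stdπ G).ker.subtype =
      MulAut.conj.comp (MonoidHom.inr (Multiplicative M) (stdπ G).ker) := by
    apply kerHom_ext
    intro l k
    apply MulEquiv.ext
    intro x
    change stdAction (z : (Fin 3 → G) → M) (stdCocycle l k : StdGroup G) x =
      ((1, stdCocycle l k) : StdModule G M) * x * (1, stdCocycle l k)⁻¹
    refine Prod.ext ?_ ?_
    · obtain ⟨y, rfl⟩ := (stdAction (z : (Fin 3 → G) → M) (stdBasis (l * k))).surjective x
      have h1 := congrArg (fun w => (stdAction (z : (Fin 3 → G) → M) w y).1) (stdCocycle_mul l k)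
      simp only [map_mul, MulAut.mul_apply] at h1
      rw [h1]
      simp only [stdAction_basis]
      have h2 := kerHom_conj z l k y.2
      apply Multiplicative.toAdd.injective
      simp [stdAut, ← h2, mul_smul, add_assoc]
    · rw [stdAction_snd]
      apply Subtype.ext
      rw [MulAut.conjNormal_apply]
      rfl
  exact DFunLike.congr_fun (DFunLike.congr_fun e r) x

end Cocycle

/-- The standard extension with respect to a componentwise pointed `3`-cocycle `z`:
`M → M × Ker π → F → G`, where `F` acts on `M × Ker π` as in `stdAction_inl` and
`stdAction_stdCocycle`; these formulas determine the action. -/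
def stdExtension (z : cptCocycles G M 3) : Extension G M :=
  letI act : MulDistribMulAction (StdGroup G) (StdModule G M) :=
    MulDistribMulAction.compHom (StdModule G M) (stdAction (z : (Fin 3 → G) → M))
  { gp := StdGroup G
    mp := StdModule G M
    action := act
    struct := (stdπ G).ker.subtype.comp (MonoidHom.snd _ _)
    equivariance := fun w x => by
      change ((stdAction (z : (Fin 3 → G) → M) w x).2 : StdGroup G) = _
      rw [stdAction_snd, MulAut.conjNormal_apply]
      rfl
    peiffer := fun n x => by
      change stdAction (z : (Fin 3 → G) → M) n.2 x = _
      rw [stdAction_ker]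
      ext <;> simp [mul_comm n.1]
    ι := MonoidHom.inl _ _
    π := stdπ G
    ι_injective := fun a b h => congrArg Prod.fst h
    π_surjective := fun g => ⟨stdBasis g, stdπ_basis g⟩
    exact_mp := by
      ext x
      constructor
      · rintro ⟨m, rfl⟩
        rfl
      · intro hx
        exact ⟨x.1, Prod.ext rfl (Subtype.ext (Eq.symm hx))⟩
    exact_gp := by
      ext w
      constructor
      · rintro ⟨x, rfl⟩
        exact x.2.2
      · intro hw
        exact ⟨(1, ⟨w, hw⟩), rfl⟩
    ι_smul := fun w m => stdAction_inl _ w m }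

/-- Standard extensions with respect to cohomologous cocycles are extension equivalent. -/
theorem stdExtension_equivalence (z z' : cptCocycles G M 3) (c : (Fin 2 → G) → M)
    (hc : c ∈ cptCochains G M 2)
    (h' : -(z : (Fin 3 → G) → M) + z' = differential G M 2 c) :
    Nonempty ((stdExtension z').Equivalence (stdExtension z)) := by
  have h₁ : ∀ g, -c ![1, g] = 0 := fun g => by rw [hc _ ⟨0, rfl⟩, neg_zero]
  have h₂ : ∀ h, -c ![h, 1] = 0 := fun h => by rw [hc _ ⟨1, rfl⟩, neg_zero]
  let θ : (stdπ G).ker →* Multiplicative M := kerHom fun h g => -c ![h, g]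
  have hθ : ∀ h g, θ (stdCocycle h g) = Multiplicative.ofAdd (-c ![h, g]) :=
    kerHom_stdCocycle h₁ h₂
  let f : StdModule G M →* StdModule G M :=
    { toFun := fun x => (x.1 * θ x.2, x.2)
      map_one' := by simp
      map_mul' := fun x y => by
        refine Prod.ext ?_ rfl
        change x.1 * y.1 * θ (x.2 * y.2) = x.1 * θ x.2 * (y.1 * θ y.2)
        rw [map_mul, mul_mul_mul_comm] }
  have hk : ∀ (k : G) (r : (stdπ G).ker),
      kerHom (fun h g => -(z' : (Fin 3 → G) → M) ![k, h, g]) r *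
        θ (MulAut.conjNormal (stdBasis k) r) =
      Multiplicative.ofAdd (k • Multiplicative.toAdd (θ r)) *
        kerHom (fun h g => -(z : (Fin 3 → G) → M) ![k, h, g]) r := by
    intro k r
    have e : kerHom (fun h g => -(z' : (Fin 3 → G) → M) ![k, h, g]) *
          θ.comp (MulAut.conjNormal (stdBasis k)).toMonoidHom =
        (AddMonoidHom.toMultiplicative (DistribSMul.toAddMonoidHom M k)).comp θ *
          kerHom (fun h g => -(z : (Fin 3 → G) → M) ![k, h, g]) := by
      apply kerHom_ext
      intro h g
      change kerHom (M := M) _ (stdCocycle h g) * θ (MulAut.conjNormal (stdBasis k) (stdCocycle h g)) =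
        Multiplicative.ofAdd (k • Multiplicative.toAdd (θ (stdCocycle h g))) *
          kerHom (M := M) _ (stdCocycle h g)
      rw [conj_stdCocycle, map_mul, map_mul, map_inv]
      simp only [kerHom_cocycle, hθ]
      rw [← ofAdd_neg, ← ofAdd_add, ← ofAdd_add, ← ofAdd_add, toAdd_ofAdd, ← ofAdd_add]
      congr 1
      have hz := congrFun h' ![k, h, g]
      rw [differential_two_apply] at hz
      change -(z : (Fin 3 → G) → M) ![k, h, g] + (z' : (Fin 3 → G) → M) ![k, h, g] =
        k • c ![h, g] - c ![k * h, g] + c ![k, h * g] - c ![k, h] at hz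
      rw [← sub_eq_zero, ← neg_eq_zero, ← sub_eq_zero.2 hz, smul_neg]
      abel
    exact DFunLike.congr_fun e r
  have hf : ∀ (w : StdGroup G) (x : StdModule G M),
      f (stdAction (z' : (Fin 3 → G) → M) w x) = stdAction (z : (Fin 3 → G) → M) w (f x) := by
    intro w
    induction w using FreeGroup.induction_on with
    | C1 => simp
    | of k =>
      intro x
      rw [stdAction_of, stdAction_of]
      refine Prod.ext ?_ rfl
      change Multiplicative.ofAdd (k.1 • Multiplicative.toAdd x.1) * kerHom (M := M) _ x.2 *
        θ (MulAut.conjNormal (stdBasis k.1) x.2) =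
          Multiplicative.ofAdd (k.1 • Multiplicative.toAdd (x.1 * θ x.2)) * kerHom (M := M) _ x.2
      rw [mul_assoc, hk, toAdd_mul, smul_add, ofAdd_add, mul_assoc]
    | inv_of k ih =>
      intro x
      change f (stdAction _ (FreeGroup.of k)⁻¹ x) = stdAction _ (FreeGroup.of k)⁻¹ (f x)
      have h1 := ih ((stdAction (z' : (Fin 3 → G) → M) (FreeGroup.of k))⁻¹ x)
      change f (stdAction _ (FreeGroup.of k) _) = stdAction _ (FreeGroup.of k) _ at h1
      rw [MulAut.apply_inv_self] at h1
      rw [map_inv, map_inv, h1, MulAut.inv_apply_self]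
    | mul v w hv hw =>
      intro x
      rw [map_mul, map_mul, MulAut.mul_apply, MulAut.mul_apply, hv, hw]
  exact ⟨{
    gpHom := MonoidHom.id (StdGroup G)
    mpHom := f
    comm := fun _ => rfl
    map_smul := hf
    mpHom_ι := fun m => Prod.ext
      (show m * θ 1 = m by rw [map_one, mul_one]) rfl
    π_gpHom := fun _ => rfl }⟩

variable (G M) in
/-- The map `H³_cpt(G, M) → Ext²(G, M)` that sends the class of `z` to the class of the standard
extension with respect to `z`. -/
def extensionOfClass : CptCohomology G M 3 → ExtensionClass G M :=
  Quotient.lift (fun z => (stdExtension z).toClass) fun z z' h => by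
    have h' := AddSubgroup.mem_addSubgroupOf.1 (QuotientAddGroup.leftRel_apply.1 h)
    obtain ⟨c, hc, hcz⟩ := exists_cpt_of_mem_cptCoboundaries h'
    exact (Extension.toClass_eq (stdExtension_equivalence z z' c hc hcz.symm).some).symm

end Standard

end CrossedExt

end

namespace CrossedExt

open CategoryTheory

/-! ## Comparison of pointed and unpointed cohomology -/

section Comparison

variable {G M : Type u} [Group G] [AddCommGroup M] [DistribMulAction G M]

/-! Both round trips rest on one fact about the free group `F` on `(G, 1)`: a homomorphism out of
`Ker π` is the same as a componentwise pointed map on `G × G`, given by its values on the elements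
`c(h, g)`. Uniqueness is `kerHom_ext`; existence for a possibly non-abelian target is
`kerLift_stdCocycle`.

Starting from a cocycle `z`, the basis of `F` and the elements `(0, c(h, g))` form a lifting system
for `E(z)`. The action of `F` was defined so that the cocycle of this lifting system is `z` itself
(`stdLiftingSystem_cochain`), hence `cl(E(z))` is the class of `z`.

Starting from an extension `E` with lifting system `Z`, freeness of `F` gives `F → E₀` with `s(g) ↦
Z₁(g)`, and the fact above gives `Ker π → E₁` with `c(h, g) ↦ Z₂(h, g)`. Combined with `ι` on `M`,
these form an extension equivalence from the standard extension of the cocycle of `Z` to `E`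
(`stdEquivalence`). Equivariance is the defining relation `Z₂_mul` of that cocycle.

The passage to `H³(G, M)` is a normalisation argument: subtracting explicit coboundaries makes any
`3`-cocycle componentwise pointed. -/

theorem differential_comp (n : ℕ) (c : (Fin n → G) → M) :
    differential G M (n + 1) (differential G M n c) = 0 := by
  have h := congrArg (fun f => f.hom c) (groupCohomology.inhomogeneousCochains.d_comp_d (coeffRep G M) (n := n))
  exact h

theorem cocyclesToCohomology_surjective (n : ℕ) :
    Function.Surjective (cocyclesToCohomology G M n) := by
  intro x
  refine groupCohomology_induction_on x fun y => ?_
  have hy : differential G M n (groupCohomology.iCocycles (coeffRep G M) n y) = 0 := by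
    have h := congrArg (fun f => f.hom y)
      ((groupCohomology.inhomogeneousCochains (coeffRep G M)).iCycles_d n (n + 1))
    have h' := congrArg (fun f => f.hom (groupCohomology.iCocycles (coeffRep G M) n y))
      (groupCohomology.inhomogeneousCochains.d_def (coeffRep G M) n)
    exact h'.symm.trans h
  refine ⟨⟨groupCohomology.iCocycles (coeffRep G M) n y, hy⟩, ?_⟩
  change groupCohomology.π (coeffRep G M) n (groupCohomology.cocyclesMk (A := coeffRep G M) _ hy) = _
  congr 1
  -- Abstract cocycles embed into cochains, so they may be compared through their underlying
  -- functions.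
  apply (ModuleCat.mono_iff_injective
    (groupCohomology.iCocycles (coeffRep G M) n)).1 inferInstance
  exact groupCohomology.iCocycles_mk _ hy

theorem mem_coboundaries_of_cocyclesToCohomology_eq_zero (n : ℕ) (z : cocycles G M (n + 1))
    (hz : cocyclesToCohomology G M (n + 1) z = 0) :
    (z : (Fin (n + 1) → G) → M) ∈ coboundaries G M (n + 1) := by
  let K := groupCohomology.inhomogeneousCochains (coeffRep G M)
  -- Cohomology is the cokernel of `Cⁿ → Zⁿ⁺¹`, so a cocycle with trivial class lifts to an
  -- `n`-cochain.
  have hex : (ShortComplex.mk _ _ (K.toCycles_comp_homologyπ n (n + 1))).Exact :=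
    ShortComplex.exact_of_g_is_cokernel _ (K.homologyIsCokernel n (n + 1) (by simp))
  obtain ⟨b, hb⟩ := (ShortComplex.moduleCat_exact_iff _).1 hex
    (groupCohomology.cocyclesMk (A := coeffRep G M) z.1 z.2) hz
  refine ⟨b, ?_⟩
  have h := congrArg (fun f => f.hom b) (K.toCycles_i n (n + 1))
  have h' := congrArg (fun f => f.hom b)
    (groupCohomology.inhomogeneousCochains.d_def (coeffRep G M) n)
  have h'' := congrArg (groupCohomology.iCocycles (coeffRep G M) (n + 1)) hb
  exact (h'.symm.trans h.symm).trans (h''.trans (groupCohomology.iCocycles_mk _ z.2))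

/-- Every `3`-cocycle is cohomologous to a componentwise pointed one. -/
theorem exists_sub_differential_mem_cptCochains {z : (Fin 3 → G) → M} (hz : z ∈ cocycles G M 3) :
    ∃ b : (Fin 2 → G) → M, z - differential G M 2 b ∈ cptCocycles G M 3 := by
  have identity : ∀ w ∈ cocycles G M 3, ∀ l k h g : G,
      l • w ![k, h, g] - w ![l * k, h, g] + w ![l, k * h, g] - w ![l, k, h * g]
        + w ![l, k, h] = 0 := by
    intro w hw l k h g
    have h1 := congrFun (show differential G M 3 w = 0 from hw) ![l, k, h, g]
    rw [differential_three_apply] at h1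
    exact h1
  have sub_mem : ∀ w ∈ cocycles G M 3, ∀ b, w - differential G M 2 b ∈ cocycles G M 3 :=
    fun w hw b => (cocycles G M 3).sub_mem hw (differential_comp 2 b)
  obtain ⟨b, hb⟩ : ∃ b : (Fin 2 → G) → M, ∀ h g, (z - differential G M 2 b) ![1, h, g] = 0 := by
    -- The cocycle identity at `(1, 1, h, g)` reads `z(1,h,g) = z(1,1,hg) - z(1,1,h)`, and the
    -- right-hand side is the value at `(1, h, g)` of the coboundary of this cochain.
    refine ⟨fun x => z ![1, 1, x 1], fun h g => ?_⟩
    have e := identity z hz 1 1 h g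
    simp only [one_smul, one_mul] at e
    rw [Pi.sub_apply, differential_two_apply, ← e]
    simp
    abel
  have hw := sub_mem z hz b
  generalize hwz : z - differential G M 2 b = w at hb hw
  -- Once `w` vanishes for first argument `1`, the identity at `(k, 1, 1, g)` gives `w(k,1,g) =
  -- w(k,1,1)`. The second correction removes this value, and its coboundary vanishes at `(1, h,
  -- g)`, so the first normalisation survives.
  refine ⟨b + fun x => -w ![x 0, 1, 1], ?_⟩
  rw [map_add, ← sub_sub, hwz]
  have hv := sub_mem w hw fun x => -w ![x 0, 1, 1]
  refine ⟨?_, hv⟩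
  have h0 : ∀ h g, (w - differential G M 2 fun x => -w ![x 0, 1, 1]) ![1, h, g] = 0 := by
    intro h g
    rw [Pi.sub_apply, differential_two_apply]
    simp [hb]
  have h1 : ∀ k g, (w - differential G M 2 fun x => -w ![x 0, 1, 1]) ![k, 1, g] = 0 := by
    intro k g
    have e := identity w hw k 1 1 g
    simp only [mul_one, one_mul, hb, smul_zero] at e
    rw [Pi.sub_apply, differential_two_apply, ← neg_eq_zero, ← e]
    simp [hb]
    abel
  generalize (w - differential G M 2 fun x => -w ![x 0, 1, 1]) = v at hv h0 h1
  -- No third correction is needed: in the identity at `(k, h, 1, 1)` the terms with middle argument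
  -- `1` vanish, and of the three copies of `v(k,h,1)` one is left.
  have h2 : ∀ k h, v ![k, h, 1] = 0 := by
    intro k h
    have e := identity v hv k h 1 1
    simpa [h1] using e
  rintro x ⟨i, hi⟩
  obtain ⟨k, h, g, rfl⟩ : ∃ k h g : G, x = ![k, h, g] :=
    ⟨x 0, x 1, x 2, by ext i; fin_cases i <;> rfl⟩
  fin_cases i
  · obtain rfl : k = 1 := hi
    exact h0 h g
  · obtain rfl : h = 1 := hi
    exact h1 k g
  · obtain rfl : g = 1 := hi
    exact h2 k h

variable (G M) in
-- Injectivity is immediate because a componentwise pointed coboundary is only required to bound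
-- some cochain, not a pointed one. Surjectivity is the normalisation of cocycles.
theorem cptToCohomology_three_bijective : Function.Bijective (cptToCohomology G M 3) := by
  constructor
  · rw [injective_iff_map_eq_zero]
    intro x hx
    obtain ⟨z, rfl⟩ := QuotientAddGroup.mk_surjective x
    exact (QuotientAddGroup.eq_zero_iff z).2 (AddSubgroup.mem_addSubgroupOf.2
      ⟨z.2.1, mem_coboundaries_of_cocyclesToCohomology_eq_zero 2 ⟨z.1, z.2.2⟩ hx⟩)
  · intro y
    obtain ⟨z, rfl⟩ := cocyclesToCohomology_surjective 3 y
    obtain ⟨b, hb⟩ := exists_sub_differential_mem_cptCochains z.2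
    refine ⟨cptClass G M ⟨_, hb⟩, ?_⟩
    change cocyclesToCohomology G M 3 ⟨_, hb.2⟩ = _
    rw [← sub_eq_zero, ← map_sub]
    apply cocyclesToCohomology_eq_zero
    refine ⟨-b, ?_⟩
    change differential G M 2 (-b) = z.1 - differential G M 2 b - z.1
    rw [map_neg, sub_sub_cancel_left]

end Comparison

/-! ## The classification of crossed module extensions -/

section Classification

variable {G M : Type u} [Group G] [AddCommGroup M] [DistribMulAction G M]

/-- Independence of the lifting system allows the class to be computed from whichever one is
convenient. -/
theorem Extension.classOfExtension_toClass {E : Extension G M} (Z : E.LiftingSystem) :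
    classOfExtension G M E.toClass = Z.cohomologyClass :=
  LiftingSystem.cohomologyClass_eq _ Z

/-- The identity of `G` is a section that is a homomorphism, so its non-abelian `2`-cocycle is
trivial and lifts to the constant `1`. The resulting `3`-cocycle is zero. -/
theorem classOfExtension_trivialExtension :
    classOfExtension G M (trivialExtension G M).toClass = 0 := by
  let Z : (trivialExtension G M).LiftingSystem :=
    { Z₁ := fun g => g
      Z₂ := fun _ _ => 1
      Z₁_one := rfl
      π_Z₁ := fun _ => rfl
      struct_Z₂ := fun h g => (mul_inv_cancel (h * g)).symm
      Z₂_one_left := fun _ => rfl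
      Z₂_one_right := fun _ => rfl }
  rw [Extension.classOfExtension_toClass Z]
  have hZ : Z.cochain = 0 := by
    funext x
    obtain ⟨k, h, g, rfl⟩ : ∃ k h g : G, x = ![k, h, g] :=
      ⟨x 0, x 1, x 2, by ext i; fin_cases i <;> rfl⟩
    refine (Z.eq_cochain (m := 0) ?_).symm
    change (1 * 1 : (trivialExtension G M).mp) = _ * (_ • (1 : (trivialExtension G M).mp)) * 1
    rw [smul_one, ofAdd_zero, map_one, one_mul, one_mul]
  have h : (⟨Z.cochain, Z.cochain_mem⟩ : cptCocycles G M 3) = 0 := Subtype.ext hZ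
  exact congrArg (cptClass G M) h

/-! ### The cocycle of a standard extension -/

/-- The lifting system for the standard extension given by the basis and its non-abelian
`2`-cocycle. -/
noncomputable def stdLiftingSystem (z : cptCocycles G M 3) : (stdExtension z).LiftingSystem where
  Z₁ := stdBasis
  Z₂ h g := ((1, stdCocycle h g) : StdModule G M)
  Z₁_one := stdBasis_one
  π_Z₁ := stdπ_basis
  struct_Z₂ _ _ := rfl
  Z₂_one_left g := Prod.ext rfl (Subtype.ext (by
    change nonabelianCocycle stdBasis 1 g = 1
    simp [nonabelianCocycle, stdBasis_one]))
  Z₂_one_right h := Prod.ext rfl (Subtype.ext (by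
    change nonabelianCocycle stdBasis h 1 = 1
    simp [nonabelianCocycle, stdBasis_one]))

/-- The action of `s(k)` introduces the summand `-z(k,h,g)` in `M`, so `z(k,h,g)` is exactly what
restores the defining relation of the cocycle. The equality holds for cochains, not just for
classes. -/
theorem stdLiftingSystem_cochain (z : cptCocycles G M 3) :
    (stdLiftingSystem z).cochain = z := by
  funext x
  obtain ⟨k, h, g, rfl⟩ : ∃ k h g : G, x = ![k, h, g] :=
    ⟨x 0, x 1, x 2, by ext i; fin_cases i <;> rfl⟩
  refine ((stdLiftingSystem z).eq_cochain ?_).symm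
  have e : ((1, stdCocycle k h) * (1, stdCocycle (k * h) g) : StdModule G M) =
      ((Multiplicative.ofAdd ((z : (Fin 3 → G) → M) ![k, h, g]), 1) : StdModule G M) *
        stdAction (z : (Fin 3 → G) → M) (stdBasis k) (1, stdCocycle h g) *
          (1, stdCocycle k (h * g)) := by
    rw [stdAction_stdCocycle]
    ext <;> simp
  exact e

theorem classOfExtension_extensionOfClass (x : CptCohomology G M 3) :
    classOfExtension G M (extensionOfClass G M x) = x := by
  obtain ⟨z, rfl⟩ := QuotientAddGroup.mk_surjective x
  refine (Extension.classOfExtension_toClass (stdLiftingSystem z)).trans ?_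
  exact congrArg (cptClass G M) (Subtype.ext (stdLiftingSystem_cochain z))

/-! ### Homomorphisms from `Ker π` to arbitrary groups -/

section KerLift

variable {H : Type u} [Group H]

/-- The action of `G` on maps from `G` to a group by translation, `(a • f)(x) = f(xa)`. -/
def translation (G H : Type u) [Group G] [Group H] : G →* MulAut (G → H) where
  toFun a :=
    { toFun := fun f x => f (x * a)
      invFun := fun f x => f (x * a⁻¹)
      left_inv := fun f => by funext x; simp
      right_inv := fun f => by funext x; simp
      map_mul' := fun _ _ => rfl }
  map_one' := by ext f x; simp
  map_mul' a b := by ext f x; simp [mul_assoc]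

/-- The homomorphism from `F` to the semidirect product of `Map(G, H)` and `G` that sends a free
generator `g` to `(φ(-, g), g)`. -/
def wreathLift (φ : G → G → H) : StdGroup G →* (G → H) ⋊[translation G H] G :=
  FreeGroup.lift fun g => ⟨fun x => φ x g.1, g.1⟩

theorem wreathLift_right (φ : G → G → H) (w : StdGroup G) :
    (wreathLift φ w).right = stdπ G w := by
  have h : (SemidirectProduct.rightHom).comp (wreathLift φ) = stdπ G := by
    apply FreeGroup.ext_hom
    intro g
    rw [stdπ_of, MonoidHom.comp_apply, wreathLift, FreeGroup.lift_apply_of]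
    rfl
  exact DFunLike.congr_fun h w

/-- Pointedness in the second variable is needed because `s(1) = 1` is not a free generator. -/
theorem wreathLift_basis (φ : G → G → H) (hφ : ∀ h, φ h 1 = 1) (g : G) :
    (wreathLift φ (stdBasis g)).left = fun x => φ x g := by
  by_cases h : g = 1
  · rw [h, stdBasis_one, map_one]
    funext x
    exact (hφ x).symm
  · rw [show stdBasis g = FreeGroup.of ⟨g, h⟩ from stdBasis_coe ⟨g, h⟩, wreathLift,
      FreeGroup.lift_apply_of]

/-- The homomorphism `Ker π → H` that sends `(h, g)` under the non-abelian `2`-cocycle to `φ(h, g)`,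
for a componentwise pointed map `φ : G × G → H`; see `kerLift_stdCocycle`. -/
def kerLift (φ : G → G → H) : (stdπ G).ker →* H where
  toFun r := (wreathLift φ r).left 1
  map_one' := by rw [Subgroup.coe_one, map_one]; rfl
  -- At `1` the left component of a product `rs` is `r.left(1) · s.left(π(r))`. This is
  -- multiplicative on `Ker π`, where `π(r) = 1`.
  map_mul' r s := by
    rw [Subgroup.coe_mul, map_mul, SemidirectProduct.mul_left, wreathLift_right,
      (r.2 : stdπ G r = 1), map_one]
    rfl

/-- Comparing left components at `1` in `c(h,g) s(hg) = s(h) s(g)` gives `kerLift φ (c(h,g)) ·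
φ(1,hg) = φ(1,h) · φ(h,g)`, and pointedness in the first variable removes the outer factors. With
`kerHom_ext` this is the universal property of `Ker π` as a free group on the `c(h,g)` with `h, g ≠
1`, obtained without choosing reduced words. -/
theorem kerLift_stdCocycle {φ : G → G → H} (h₁ : ∀ g, φ 1 g = 1) (h₂ : ∀ h, φ h 1 = 1)
    (h g : G) : kerLift φ (stdCocycle h g) = φ h g := by
  have e := congrArg (fun w => (wreathLift φ w).left 1) (stdCocycle_mul h g)
  have hr : stdπ G (stdCocycle h g) = 1 := (stdCocycle h g).2
  simp only [map_mul, SemidirectProduct.mul_left, wreathLift_right, stdπ_basis,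
    wreathLift_basis φ h₂, Pi.mul_apply] at e
  change kerLift φ (stdCocycle h g) * φ (1 * stdπ G (stdCocycle h g)) (h * g) =
    φ 1 h * φ (1 * h) g at e
  rwa [hr, one_mul, one_mul, h₁, h₁, mul_one, one_mul] at e

end KerLift

/-! ### Comparing a standard extension with a given extension -/

namespace Extension.LiftingSystem

variable {E : Extension G M} (Z : E.LiftingSystem)

/-- The homomorphism `F → E₀` that sends `s⁰(g)` to `Z₁(g)`. -/
def stdGpHom : StdGroup G →* E.gp :=
  FreeGroup.lift fun g => Z.Z₁ g.1

theorem stdGpHom_basis (g : G) : Z.stdGpHom (stdBasis g) = Z.Z₁ g := by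
  by_cases h : g = 1
  · rw [h, stdBasis_one, map_one, Z.Z₁_one]
  · rw [show stdBasis g = FreeGroup.of ⟨g, h⟩ from stdBasis_coe ⟨g, h⟩]
    exact FreeGroup.lift_apply_of

theorem π_stdGpHom (w : StdGroup G) : E.π (Z.stdGpHom w) = stdπ G w := by
  have h : E.π.comp Z.stdGpHom = stdπ G := by
    apply FreeGroup.ext_hom
    intro g
    rw [stdπ_of, MonoidHom.comp_apply, ← stdBasis_coe, stdGpHom_basis, π_Z₁]
  exact DFunLike.congr_fun h w

theorem kerLift_Z₂ (h g : G) : kerLift Z.Z₂ (stdCocycle h g) = Z.Z₂ h g :=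
  kerLift_stdCocycle Z.Z₂_one_left Z.Z₂_one_right h g

/-- Both sides are homomorphisms in `r`, and on the generators `c(h, g)` the claim says that `Z₂`
lifts the non-abelian `2`-cocycle of `Z₁`. -/
theorem struct_kerLift (r : (stdπ G).ker) : E.struct (kerLift Z.Z₂ r) = Z.stdGpHom r := by
  have h : E.struct.comp (kerLift Z.Z₂) = Z.stdGpHom.comp (stdπ G).ker.subtype := by
    apply kerHom_ext
    intro h g
    change E.struct (kerLift Z.Z₂ (stdCocycle h g)) = Z.stdGpHom (nonabelianCocycle stdBasis h g)
    rw [kerLift_Z₂, struct_Z₂]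
    simp only [nonabelianCocycle, map_mul, map_inv, stdGpHom_basis]
  exact DFunLike.congr_fun h r

/-- The homomorphism `M × Ker π → E₁` that is `ι` on `M` and sends `(h, g)` under the non-abelian
`2`-cocycle to `Z₂(h, g)`. -/
def stdMpHom : StdModule G M →* E.mp :=
  -- The two factors may be combined because the image of `ι` is central in `E₁`.
  MonoidHom.noncommCoprod E.ι (kerLift Z.Z₂) fun m r => E.ι_comm m (kerLift Z.Z₂ r)

theorem stdMpHom_apply (x : StdModule G M) : Z.stdMpHom x = E.ι x.1 * kerLift Z.Z₂ x.2 :=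
  rfl

/-- Equivariance can be tested on the two factors. On `M` it is the compatibility of `ι` with the
actions; on `Ker π` it reduces to the generators `c(h, g)`. -/
theorem stdMpHom_stdAut (k : G) (x : StdModule G M) :
    Z.stdMpHom (stdAut Z.cochain k x) = Z.Z₁ k • Z.stdMpHom x := by
  have h : Z.stdMpHom.comp ((stdAut Z.cochain k).toMonoidHom.comp (MonoidHom.inr _ _)) =
      (MulDistribMulAction.toMonoidHom E.mp (Z.Z₁ k)).comp (kerLift Z.Z₂) := by
    apply kerHom_ext
    intro h g
    have e := kerHom_cocycle ⟨Z.cochain, Z.cochain_mem⟩ k h g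
    change Z.stdMpHom (stdAut Z.cochain k (1, stdCocycle h g)) =
      Z.Z₁ k • kerLift Z.Z₂ (stdCocycle h g)
    simp only [stdMpHom_apply, stdAut, MulEquiv.coe_mk, Equiv.coe_fn_mk, e, conj_stdCocycle,
      map_mul, map_inv, kerLift_Z₂, toAdd_one, smul_zero, ofAdd_zero, one_mul, ofAdd_neg]
    -- The goal is the relation `Z₂_mul` solved for the translate of `Z₂(h,g)` by `Z₁(k)`; the
    -- factor `ι(-c³(k,h,g))` cancels the one from that relation.
    rw [Z₂_mul, mul_inv_cancel_right, inv_mul_cancel_left]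
  have hx : x = (x.1, 1) * (1, x.2) := by simp
  have h₁ : Z.stdMpHom (stdAut Z.cochain k (x.1, 1)) = Z.Z₁ k • E.ι x.1 := by
    rw [← ofAdd_toAdd x.1, E.ι_smul, Z.π_Z₁]
    simp [stdMpHom_apply, stdAut]
  have h₂ : Z.stdMpHom (stdAut Z.cochain k (1, x.2)) = Z.Z₁ k • kerLift Z.Z₂ x.2 :=
    DFunLike.congr_fun h x.2
  conv_lhs => rw [hx]
  rw [map_mul, map_mul, h₁, h₂, stdMpHom_apply, smul_mul']

theorem stdMpHom_stdAction (w : StdGroup G) (x : StdModule G M) :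
    Z.stdMpHom (stdAction Z.cochain w x) = Z.stdGpHom w • Z.stdMpHom x := by
  induction w using FreeGroup.induction_on generalizing x with
  | C1 => simp
  | of k =>
    rw [stdAction_of, stdMpHom_stdAut, ← stdBasis_coe, stdGpHom_basis]
  | inv_of k ih =>
    -- For an inverse generator, the case of the generator is applied to the translated element and
    -- then inverted.
    have h := ih ((stdAction Z.cochain (FreeGroup.of k))⁻¹ x)
    change Z.stdMpHom (stdAction _ (FreeGroup.of k)⁻¹ x) = Z.stdGpHom (FreeGroup.of k)⁻¹ • _
    change Z.stdMpHom (stdAction _ (FreeGroup.of k) _) = Z.stdGpHom (FreeGroup.of k) • _ at h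
    rw [MulAut.apply_inv_self] at h
    rw [map_inv, map_inv, h, inv_smul_smul]
  | mul v w hv hw => rw [map_mul, MulAut.mul_apply, hv, hw, map_mul, mul_smul]

/-- The extension equivalence to `E` from the standard extension with respect to the cocycle of a
lifting system for `E`. -/
def stdEquivalence : (stdExtension ⟨Z.cochain, Z.cochain_mem⟩).Equivalence E where
  gpHom := Z.stdGpHom
  mpHom := Z.stdMpHom
  comm x := by
    change E.struct (E.ι x.1 * kerLift Z.Z₂ x.2) = Z.stdGpHom x.2
    rw [map_mul, struct_ι, one_mul, struct_kerLift]
  map_smul := Z.stdMpHom_stdAction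
  mpHom_ι m := by
    change E.ι m * kerLift Z.Z₂ 1 = E.ι m
    rw [map_one, mul_one]
  π_gpHom := Z.π_stdGpHom

end Extension.LiftingSystem

/-- A single extension equivalence from the standard extension to `E` suffices, although it need not
be invertible, since `Ext²` is a quotient by the generated equivalence relation. -/
theorem extensionOfClass_classOfExtension (e : ExtensionClass G M) :
    extensionOfClass G M (classOfExtension G M e) = e := by
  obtain ⟨E, rfl⟩ := Quotient.exists_rep e
  obtain ⟨Z⟩ := E.exists_liftingSystem
  exact (congrArg (extensionOfClass G M) (Extension.classOfExtension_toClass Z)).trans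
    (Extension.toClass_eq Z.stdEquivalence)

end Classification

end CrossedExt

theorem mainTheorem1 (G M : Type u) [Group G] [AddCommGroup M] [DistribMulAction G M] :
    Function.LeftInverse (CrossedExt.extensionOfClass G M) (CrossedExt.classOfExtension G M) ∧
    Function.RightInverse (CrossedExt.extensionOfClass G M) (CrossedExt.classOfExtension G M) ∧
    CrossedExt.classOfExtension G M (CrossedExt.trivialExtension G M).toClass = 0 ∧
    CrossedExt.extensionOfClass G M 0 = (CrossedExt.trivialExtension G M).toClass ∧
    Function.Bijective fun e : CrossedExt.ExtensionClass G M =>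
      CrossedExt.cptToCohomology G M 3 (CrossedExt.classOfExtension G M e) := by
  have hl := CrossedExt.extensionOfClass_classOfExtension (G := G) (M := M)
  have hr := CrossedExt.classOfExtension_extensionOfClass (G := G) (M := M)
  have ht := CrossedExt.classOfExtension_trivialExtension (G := G) (M := M)
  refine ⟨hl, hr, ht, ?_, ?_⟩
  -- As the maps are mutually inverse, the statement for `cl` already determines the extension class
  -- of `0`; the standard extension of the zero cocycle need not be examined.
  · rw [← ht, hl]
  · exact (CrossedExt.cptToCohomology_three_bijective G M).comp
      (Function.bijective_iff_has_inverse.2 ⟨_, hl, hr⟩)
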